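/- Conventions. Let $(X,d)$ be a metric space and let $U_d(X)$ be the unital vector lattice of all (not necessarily bounded) uniformly continuous functions $f:X\to\mathbb R$, with pointwise operations. The Samuel realcompactification $H(U_d(X))$ is the set of all real unital vector lattice homomorphisms $\xi:U_d(X)\to\mathbb R$ (linear, preserving binary suprema and infima, $\xi(1)=1$), with the topology inherited from the product $\mathbb R^{U_d(X)}$. The space $X$ is identified with its image under $x\mapsto(f\mapsto f(x))$, and $(X,d)$ is called Samuel realcompact if $X=H(U_d(X))$, that is, if this map is a homeomorphism of $X$ onto $H(U_d(X))$. For $x\in X$ and $\varepsilon>0$ let $B^1_d(x,\varepsilon)$ be the open ball $B_d(x,\varepsilon)$ and let $B^{m+1}_d(x,\varepsilon)=\bigcup\{B_d(y,\varepsilon): y\in B^m_d(x,\varepsilon)\}$. A net $(x_\lambda)_{\lambda\in\Lambda}$ in $X$ is Bourbaki-Cauchy if for every $\varepsilon>0$ there are $m\ge 1$, $\lambda_0\in\Lambda$ and $x_0\in X$ with $x_\lambda\in B^m_d(x_0,\varepsilon)$ for all $\lambda\ge\lambda_0$; $(X,d)$ is Bourbaki-complete if every Bourbaki-Cauchy net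 has a cluster point in $X$. A subspace $S\subseteq X$ is uniformly discrete if there is $\varepsilon>0$ with $d(x,y)>\varepsilon$ for all distinct $x,y\in S$. A uniform partition of $X$ is a partition $\mathcal P$ of $X$ into nonempty sets for which there is $\varepsilon>0$ such that every open ball of radius $\varepsilon$ is contained in a member of $\mathcal P$. A cardinal $\kappa$ is measurable if a set $S$ of cardinal $\kappa$ carries a countably additive measure $\mu$, defined on all subsets of $S$ and taking only the values $0$ and $1$, such that $\mu(S)=1$ and $\mu(\{s\})=0$ for every $s\in S$; otherwise $\kappa$ is non-measurable. Theorem. For every metric space $(X,d)$: (a) $(X,d)$ is Samuel realcompact if and only if it is Bourbaki-complete and every uniformly discrete subspace of $X$ has non-measurable cardinal. (b) $(X,d)$ is Samuel realcompact if and only if it is Bourbaki-complete and every uniform partition of $X$ has non-measurable cardinal. -/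

import Mathlib

open Filter Topology

universe u

noncomputable section

/-- The vector space `U_d(X)` of all uniformly continuous functions `X → ℝ` (not necessarily
bounded), with pointwise operations. -/
def UnifFun (X : Type u) [MetricSpace X] : Submodule ℝ (X → ℝ) where
  carrier := {f | UniformContinuous f}
  add_mem' := fun hf hg => UniformContinuous.add hf hg
  zero_mem' := uniformContinuous_const
  smul_mem' := fun c _ hf => UniformContinuous.const_smul hf c

namespace UnifFun

variable {X : Type u} [MetricSpace X]

theorem sup_mem {f g : X → ℝ} (hf : f ∈ UnifFun X) (hg : g ∈ UnifFun X) : f ⊔ g ∈ UnifFun X :=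
  lipschitzWith_max.uniformContinuous.comp (UniformContinuous.prodMk hf hg)

theorem inf_mem {f g : X → ℝ} (hf : f ∈ UnifFun X) (hg : g ∈ UnifFun X) : f ⊓ g ∈ UnifFun X :=
  lipschitzWith_min.uniformContinuous.comp (UniformContinuous.prodMk hf hg)

/-- The pointwise supremum. -/
instance : Max (UnifFun X) := ⟨fun f g => ⟨(f : X → ℝ) ⊔ (g : X → ℝ), sup_mem f.2 g.2⟩⟩

/-- The pointwise infimum. -/
instance : Min (UnifFun X) := ⟨fun f g => ⟨(f : X → ℝ) ⊓ (g : X → ℝ), inf_mem f.2 g.2⟩⟩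

/-- The constant function `1`. -/
instance : One (UnifFun X) := ⟨⟨fun _ => 1, uniformContinuous_const⟩⟩

end UnifFun

/-- A real-valued map on `U_d(X)` is a unital vector lattice homomorphism: it is linear, preserves
binary suprema and infima, and maps the constant function `1` to `1`. -/
structure IsUnitalVectorLatticeHom {X : Type u} [MetricSpace X] (ξ : UnifFun X → ℝ) : Prop where
  map_add : ∀ f g, ξ (f + g) = ξ f + ξ g
  map_smul : ∀ (c : ℝ) f, ξ (c • f) = c * ξ f
  map_sup : ∀ f g, ξ (f ⊔ g) = max (ξ f) (ξ g)
  map_inf : ∀ f g, ξ (f ⊓ g) = min (ξ f) (ξ g)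
  map_one : ξ 1 = 1

/-- The Samuel realcompactification `H(U_d(X))`: all real unital vector lattice homomorphisms on
`U_d(X)`. As a subtype of `UnifFun X → ℝ` it carries the topology of pointwise convergence
(the subspace topology of the product `ℝ^{U_d(X)}`). -/
def SamuelRealcompactification (X : Type u) [MetricSpace X] : Set (UnifFun X → ℝ) :=
  {ξ | IsUnitalVectorLatticeHom ξ}

/-- The canonical map `X → H(U_d(X))`, sending `x` to the evaluation `f ↦ f x`. -/
def samuelEval (X : Type u) [MetricSpace X] (x : X) : SamuelRealcompactification X :=
  ⟨fun f => (f : X → ℝ) x,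
    { map_add := fun _ _ => rfl
      map_smul := fun _ _ => rfl
      map_sup := fun _ _ => rfl
      map_inf := fun _ _ => rfl
      map_one := rfl }⟩

/-- `X` is Samuel realcompact if `X = H(U_d(X))`, i.e. the canonical map identifies the space `X`
with the whole of `H(U_d(X))`. -/
def IsSamuelRealcompact (X : Type u) [MetricSpace X] : Prop :=
  IsHomeomorph (samuelEval X)

/-- The iterated balls `B^m_d(x, ε)`: `B^1` is the open ball `B_d(x, ε)` and `B^{m+1}` is the union
of the open balls `B_d(y, ε)` with `y ∈ B^m`. (Starting the recursion with `B^0 = {x}` gives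
`B^1 = B_d(x, ε)`.) -/
def iterBall {X : Type u} [MetricSpace X] (x : X) (ε : ℝ) : ℕ → Set X
  | 0 => {x}
  | m + 1 => ⋃ y ∈ iterBall x ε m, Metric.ball y ε

theorem iterBall_one {X : Type u} [MetricSpace X] (x : X) (ε : ℝ) :
    iterBall x ε 1 = Metric.ball x ε := by
  simp [iterBall]

/-- A net `a : Λ → X` is Bourbaki-Cauchy if for every `ε > 0` it is eventually in one iterated
ball `B^m_d(x₀, ε)`. -/
def IsBourbakiCauchyNet {X : Type u} [MetricSpace X] {Λ : Type u} [Preorder Λ] (a : Λ → X) : Prop :=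
  ∀ ε : ℝ, 0 < ε → ∃ m : ℕ, 1 ≤ m ∧ ∃ lam₀ : Λ, ∃ x₀ : X, ∀ lam, lam₀ ≤ lam → a lam ∈ iterBall x₀ ε m

/-- `X` is Bourbaki-complete if every Bourbaki-Cauchy net in `X` has a cluster point. (Index sets
in the universe of `X` suffice, since every proper filter on `X` comes from such a net.) -/
def IsBourbakiComplete (X : Type u) [MetricSpace X] : Prop :=
  ∀ (Λ : Type u) [Preorder Λ] [IsDirectedOrder Λ] [Nonempty Λ] (a : Λ → X),
    IsBourbakiCauchyNet a → ∃ x : X, MapClusterPt x atTop a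

/-- A cardinal `κ` is measurable (in the sense of Ulam, as in the theory of realcompact spaces) if
a set of cardinal `κ` carries a countably additive measure, defined on all its subsets and taking
only the values `0` and `1`, that vanishes on points and gives the whole set the value `1`. -/
def IsUlamMeasurable (κ : Cardinal.{u}) : Prop :=
  ∃ α : Type u, Cardinal.mk α = κ ∧ ∃ μ : @MeasureTheory.Measure α ⊤,
    (∀ A : Set α, μ A = 0 ∨ μ A = 1) ∧ (∀ a : α, μ {a} = 0) ∧ μ Set.univ = 1

/-- A subset `S` is uniformly discrete (as a subspace) if for some `ε > 0` any two distinct points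
of `S` are at distance greater than `ε`. -/
def IsUniformlyDiscreteSet {X : Type u} [MetricSpace X] (S : Set X) : Prop :=
  ∃ ε : ℝ, 0 < ε ∧ S.Pairwise fun x y => ε < dist x y

/-- A uniform partition of `X`: a partition of `X` (into nonempty sets) that is a uniform cover,
i.e. for some `ε > 0` every open ball of radius `ε` lies in a member of the partition. -/
def IsUniformPartition {X : Type u} [MetricSpace X] (P : Set (Set X)) : Prop :=
  Setoid.IsPartition P ∧ ∃ ε : ℝ, 0 < ε ∧ ∀ x : X, ∃ A ∈ P, Metric.ball x ε ⊆ A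

end

/-! A homomorphism `ξ : U_d(X) → ℝ` is the same thing as the limit functional of an ultrafilter
on `X` along which every uniformly continuous function is bounded
(`IsUnitalVectorLatticeHom.exists_ultrafilter_tendsto`,
`exists_isUnitalVectorLatticeHom_tendsto`), and `ξ` is the evaluation at `x` exactly when the
ultrafilter converges to `x`. As `samuelEval X` is always an embedding, Samuel realcompactness says
that every ultrafilter of this kind converges.

Two sorts of ultrafilter have this boundedness property: those containing an iterated ball of every
radius `ε`, and the countably complete ones. The first give Bourbaki-completeness. The second
include the ultrafilter of a two-valued measure on a uniformly discrete set, whose convergence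
would force an atom.

Conversely, take an ultrafilter along which uniformly continuous functions are bounded and fix
`ε > 0`. All functions that are constant on the `ε`-chain components are uniformly continuous, so
the image of the ultrafilter on the set of components is countably complete; if the number of
components is not measurable, then one component `C` belongs to the ultrafilter. The function
`chainHeight`, which measures how many `ε`-steps away from a base point of `C` a point is, is
uniformly continuous (`uniformContinuous_chainHeight`), and it is bounded on some member of the
ultrafilter; hence an iterated `ε`-ball belongs to the ultrafilter
(`exists_iterBall_mem_of_bounded`), and Bourbaki-completeness yields the limit.

Finally, representatives of the members of a uniform partition form a uniformly discrete set, which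
links the two cardinality conditions. -/

/-! ### Ultrafilters and two-valued measures -/

/-- All real functions are bounded along `l`, as is the case when `l` is countably complete. -/
theorem Ultrafilter.exists_eventually_abs_le_of_countableInter {α : Type u} (l : Ultrafilter α)
    [CountableInterFilter (l : Filter α)] (f : α → ℝ) : ∃ K : ℝ, ∀ᶠ x in l, |f x| ≤ K := by
  by_contra! h
  obtain ⟨x, hx⟩ := (eventually_countable_forall.2 fun n : ℕ => h n).exists
  obtain ⟨n, hn⟩ := exists_nat_gt |f x|
  exact lt_asymm hn (hx n)

/-- An ultrafilter along which all real functions are bounded is countably complete: otherwise the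
index of the first set containing a given point would be an unbounded function. -/
theorem Ultrafilter.iUnion_notMem_of_forall_bounded {α : Type u} (l : Ultrafilter α)
    (hl : ∀ f : α → ℝ, ∃ K : ℝ, ∀ᶠ x in l, f x ≤ K) (A : ℕ → Set α) (hA : ∀ n, A n ∉ l) :
    (⋃ n, A n) ∉ l := by
  intro hU
  obtain ⟨K, hK⟩ := hl fun x => ((sInf {n | x ∈ A n} : ℕ) : ℝ)
  obtain ⟨N, hN⟩ := exists_nat_ge K
  have h1 : ∀ᶠ x in (l : Filter α), ∀ n ∈ Set.Iic N, x ∉ A n :=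
    (eventually_all_finite (Set.finite_Iic N)).2 fun n _ => Ultrafilter.eventually_not.2 (hA n)
  obtain ⟨x, ⟨h2, h3⟩, h4⟩ := ((hK.and h1).and hU).exists
  obtain ⟨n, hn⟩ := Set.mem_iUnion.1 h4
  exact h3 _ (by exact_mod_cast h2.trans hN) (Nat.sInf_mem (s := {n | x ∈ A n}) ⟨n, hn⟩)

/-- A free ultrafilter along which all real functions are bounded defines a two-valued measure. -/
theorem isUlamMeasurable_of_ultrafilter {α : Type u} (l : Ultrafilter α)
    (hl : ∀ f : α → ℝ, ∃ K : ℝ, ∀ᶠ x in l, f x ≤ K) (hfree : ∀ a, {a} ∉ l) :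
    IsUlamMeasurable (Cardinal.mk α) := by
  classical
  let : MeasurableSpace α := ⊤
  let m : Set α → ENNReal := fun s => if s ∈ l then 1 else 0
  have m0 : m ∅ = 0 := if_neg (Ultrafilter.empty_notMem)
  let μ : MeasureTheory.Measure α := MeasureTheory.Measure.ofMeasurable (fun s _ => m s) m0 (by
    intro A _ hd
    by_cases h : ∃ n, A n ∈ l
    · obtain ⟨n, hn⟩ := h
      rw [tsum_eq_single n]
      · simp only [m, if_pos hn]
        exact if_pos (mem_of_superset hn (Set.subset_iUnion A n))
      · intro k hk
        refine if_neg fun hk' => ?_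
        have := inter_mem hk' hn
        rw [(hd hk).inter_eq] at this
        exact Ultrafilter.empty_notMem this
    · push Not at h
      have h' : ∀ n, m (A n) = 0 := fun n => if_neg (h n)
      simp only [h', tsum_zero]
      exact if_neg (l.iUnion_notMem_of_forall_bounded hl A h))
  have hμ : ∀ s, μ s = m s := fun s =>
    MeasureTheory.Measure.ofMeasurable_apply s MeasurableSpace.measurableSet_top
  refine ⟨α, rfl, μ, fun A => ?_, fun a => ?_, ?_⟩
  · rw [hμ]
    by_cases h : A ∈ l
    · exact Or.inr (if_pos h)
    · exact Or.inl (if_neg h)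
  · rw [hμ]
    exact if_neg (hfree a)
  · rw [hμ]
    exact if_pos univ_mem

/-- The sets of full measure of a two-valued measure form a free countably complete ultrafilter. -/
theorem IsUlamMeasurable.exists_ultrafilter {α : Type u} (h : IsUlamMeasurable (Cardinal.mk α)) :
    ∃ l : Ultrafilter α, CountableInterFilter (l : Filter α) ∧ ∀ a, {a} ∉ l := by
  obtain ⟨β, hβ, μ, h01, hfree, huniv⟩ := h
  obtain ⟨e⟩ := Cardinal.eq.1 hβ
  let : MeasurableSpace β := ⊤
  have hcompl : ∀ s : Set β, μ sᶜ = 1 - μ s := fun s => by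
    have hs : μ s ≠ ⊤ := by rcases h01 s with h | h <;> simp [h]
    rw [MeasureTheory.measure_compl MeasurableSpace.measurableSet_top hs, huniv]
  let l : Ultrafilter β := Ultrafilter.ofComplNotMemIff (MeasureTheory.ae μ) (fun s => by
    rw [MeasureTheory.mem_ae_iff, MeasureTheory.mem_ae_iff, compl_compl, hcompl]
    rcases h01 s with h | h <;> simp [h])
  have : CountableInterFilter (l : Filter β) :=
    inferInstanceAs (CountableInterFilter (MeasureTheory.ae μ))
  refine ⟨l.map e, ?_, fun a ha => ?_⟩
  · rw [Ultrafilter.coe_map]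
    infer_instance
  · have h1 : e ⁻¹' {a} ∈ MeasureTheory.ae μ := ha
    have h2 : e ⁻¹' {a} = {e.symm a} := by
      ext b
      simp [Equiv.eq_symm_apply]
    rw [h2, MeasureTheory.mem_ae_iff, hcompl, hfree] at h1
    simp at h1

/-! ### Homomorphisms as limits along ultrafilters -/

section

variable {X : Type u} [MetricSpace X]

/-- The distance to a point, as an element of `U_d(X)`. -/
def UnifFun.distTo (x : X) : UnifFun X :=
  ⟨fun y => dist y x, uniformContinuous_id.dist uniformContinuous_const⟩

theorem isEmbedding_samuelEval (X : Type u) [MetricSpace X] : IsEmbedding (samuelEval X) := by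
  refine IsInducing.isEmbedding (isInducing_iff_nhds.2 fun x => le_antisymm ?_ ?_)
  · refine map_le_iff_le_comap.1 (Continuous.tendsto (f := samuelEval X) ?_ x)
    exact Continuous.subtype_mk (continuous_pi fun f => f.2.continuous) _
  · have h : Continuous fun η : SamuelRealcompactification X => η.1 (UnifFun.distTo x) :=
      (continuous_apply _).comp continuous_subtype_val
    have h1 := (h.tendsto (samuelEval X x)).comp (tendsto_comap (f := samuelEval X))
    refine tendsto_id'.1 (tendsto_iff_dist_tendsto_zero.2 ?_)
    have h2 : (samuelEval X x).1 (UnifFun.distTo x) = 0 := dist_self x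
    rw [h2] at h1
    exact h1

/-- Every homomorphism is the limit functional of some ultrafilter; so `X` is dense in
`H(U_d(X))`. -/
theorem IsUnitalVectorLatticeHom.exists_ultrafilter_tendsto {ξ : UnifFun X → ℝ}
    (hξ : IsUnitalVectorLatticeHom ξ) :
    ∃ l : Ultrafilter X, ∀ f : UnifFun X, Tendsto (f : X → ℝ) l (𝓝 (ξ f)) := by
  classical
  let e : X → UnifFun X → ℝ := fun x f => (f : X → ℝ) x
  have hne : (comap e (𝓝 ξ)).NeBot := by
    refine comap_neBot fun t ht => ?_
    rw [nhds_pi, Filter.mem_pi] at ht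
    obtain ⟨I, hI, s, hs, hst⟩ := ht
    choose δ hδ hball using fun f => Metric.mem_nhds_iff.1 (hs f)
    let h : UnifFun X → UnifFun X := fun f => f + (-ξ f) • (1 : UnifFun X)
    have hh : ∀ f, ξ (h f) = 0 := fun f => by
      simp only [h, hξ.map_add, hξ.map_smul, hξ.map_one]
      ring
    let g : UnifFun X → UnifFun X := fun f => (δ f)⁻¹ • (h f ⊔ (-1 : ℝ) • h f)
    have hg : ∀ f, ξ (g f) = 0 := fun f => by
      simp only [g, hξ.map_smul, hξ.map_sup, hh]
      simp
    have hg' : ∀ f x, (g f : X → ℝ) x = (δ f)⁻¹ * |(f : X → ℝ) x - ξ f| := fun f x => by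
      have : (g f : X → ℝ) x = (δ f)⁻¹ * max ((f : X → ℝ) x + (-ξ f) * 1)
        ((-1) * ((f : X → ℝ) x + (-ξ f) * 1)) := rfl
      rw [this, abs_eq_max_neg]
      ring_nf
    let ξ' : UnifFun X →+ ℝ := AddMonoidHom.mk' ξ hξ.map_add
    have hG : ξ (∑ f ∈ hI.toFinset, g f) = 0 := by
      change ξ' _ = 0
      rw [map_sum]
      exact Finset.sum_eq_zero fun f _ => hg f
    -- If the sum were at least `1` everywhere, so would be its image under `ξ`.
    obtain ⟨x, hx⟩ : ∃ x, ((∑ f ∈ hI.toFinset, g f : UnifFun X) : X → ℝ) x < 1 := by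
      by_contra! hcon
      have h1 : (∑ f ∈ hI.toFinset, g f) ⊔ 1 = ∑ f ∈ hI.toFinset, g f :=
        Subtype.ext (funext fun x => max_eq_left (hcon x))
      have h2 := hξ.map_sup (∑ f ∈ hI.toFinset, g f) 1
      rw [h1, hG, hξ.map_one] at h2
      norm_num at h2
    refine ⟨x, hst fun f hf => hball f ?_⟩
    rw [Submodule.coe_sum, Finset.sum_apply] at hx
    have h1 : (g f : X → ℝ) x < 1 := by
      refine lt_of_le_of_lt (Finset.single_le_sum (f := fun f => (g f : X → ℝ) x)
        (fun i _ => ?_) (hI.mem_toFinset.2 hf)) hx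
      have := hδ i
      simp only [hg']
      positivity
    rw [hg', inv_mul_lt_iff₀ (hδ f), mul_one] at h1
    exact h1
  have hle : (Ultrafilter.of (comap e (𝓝 ξ)) : Filter X) ≤ comap e (𝓝 ξ) := Ultrafilter.of_le _
  exact ⟨_, tendsto_pi_nhds.1 (tendsto_comap.mono_left hle)⟩

theorem Ultrafilter.exists_tendsto_of_eventually_abs_le {α : Type u} (l : Ultrafilter α)
    {f : α → ℝ} {K : ℝ} (hK : ∀ᶠ x in l, |f x| ≤ K) : ∃ r, Tendsto f l (𝓝 r) := by
  have h : (l.map f : Filter ℝ) ≤ 𝓟 (Set.Icc (-K) K) :=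
    le_principal_iff.2 (hK.mono fun x hx => abs_le.1 hx)
  obtain ⟨r, -, hr⟩ := isCompact_Icc.ultrafilter_le_nhds _ h
  exact ⟨r, hr⟩

/-- If every uniformly continuous function is bounded along `l`, then taking limits along `l` is a
homomorphism. -/
theorem exists_isUnitalVectorLatticeHom_tendsto (l : Ultrafilter X)
    (hl : ∀ f : UnifFun X, ∃ K : ℝ, ∀ᶠ x in l, |(f : X → ℝ) x| ≤ K) :
    ∃ ξ : UnifFun X → ℝ, IsUnitalVectorLatticeHom ξ ∧
      ∀ f : UnifFun X, Tendsto (f : X → ℝ) l (𝓝 (ξ f)) := by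
  choose ξ hξ using fun f => l.exists_tendsto_of_eventually_abs_le (hl f).choose_spec
  refine ⟨ξ, ⟨fun f g => ?_, fun c f => ?_, fun f g => ?_, fun f g => ?_, ?_⟩, hξ⟩
  · exact tendsto_nhds_unique (hξ (f + g)) ((hξ f).add (hξ g))
  · exact tendsto_nhds_unique (hξ (c • f)) ((hξ f).const_mul c)
  · exact tendsto_nhds_unique (hξ (f ⊔ g)) ((hξ f).max (hξ g))
  · exact tendsto_nhds_unique (hξ (f ⊓ g)) ((hξ f).min (hξ g))
  · exact tendsto_nhds_unique (hξ 1) tendsto_const_nhds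

theorem IsSamuelRealcompact.exists_le_nhds (hX : IsSamuelRealcompact X) (l : Ultrafilter X)
    (hl : ∀ f : UnifFun X, ∃ K : ℝ, ∀ᶠ x in l, |(f : X → ℝ) x| ≤ K) :
    ∃ x : X, (l : Filter X) ≤ 𝓝 x := by
  obtain ⟨ξ, hξ, hlim⟩ := exists_isUnitalVectorLatticeHom_tendsto l hl
  obtain ⟨x, hx⟩ := hX.surjective ⟨ξ, hξ⟩
  refine ⟨x, tendsto_id'.1 (tendsto_iff_dist_tendsto_zero.2 ?_)⟩
  have h := hlim (UnifFun.distTo x)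
  have h2 : ξ (UnifFun.distTo x) = 0 := by
    have h3 := congrFun (congrArg Subtype.val hx) (UnifFun.distTo x)
    exact h3.symm.trans (dist_self x)
  rw [h2] at h
  exact h

theorem isSamuelRealcompact_of_forall_ultrafilter
    (h : ∀ l : Ultrafilter X, (∀ f : UnifFun X, ∃ K : ℝ, ∀ᶠ x in l, |(f : X → ℝ) x| ≤ K) →
      ∃ x : X, (l : Filter X) ≤ 𝓝 x) : IsSamuelRealcompact X := by
  refine isHomeomorph_iff_isEmbedding_surjective.2 ⟨isEmbedding_samuelEval X, fun ξ => ?_⟩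
  obtain ⟨l, hl⟩ := ξ.2.exists_ultrafilter_tendsto
  obtain ⟨x, hx⟩ := h l fun f =>
    ⟨|ξ.1 f| + 1, (hl f).abs.eventually (eventually_le_nhds (lt_add_one _))⟩
  refine ⟨x, Subtype.ext (funext fun f => ?_)⟩
  exact tendsto_nhds_unique ((f.2.continuous.tendsto x).mono_left hx) (hl f)

/-! ### Iterated balls -/

theorem mem_iterBall_succ {x y : X} {ε : ℝ} {m : ℕ} :
    y ∈ iterBall x ε (m + 1) ↔ ∃ z ∈ iterBall x ε m, dist y z < ε := by
  simp [iterBall]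

theorem iterBall_mono (x : X) {ε : ℝ} (hε : 0 < ε) : Monotone (iterBall x ε) :=
  monotone_nat_of_le_succ fun _ y hy => mem_iterBall_succ.2 ⟨y, hy, by simpa⟩

theorem iterBall_nonempty (x : X) {ε : ℝ} (hε : 0 < ε) (m : ℕ) : (iterBall x ε m).Nonempty :=
  ⟨x, iterBall_mono x hε (Nat.zero_le m) rfl⟩

/-- Uniformly continuous functions are bounded on iterated balls of a suitable radius. -/
theorem UniformContinuous.exists_abs_le_on_iterBall {f : X → ℝ} (hf : UniformContinuous f) :
    ∃ ε : ℝ, 0 < ε ∧ ∀ (x : X) (m : ℕ), ∀ y ∈ iterBall x ε m, |f y| ≤ |f x| + m := by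
  obtain ⟨ε, hε, h⟩ := Metric.uniformContinuous_iff.1 hf 1 one_pos
  refine ⟨ε, hε, fun x m => ?_⟩
  induction m with
  | zero =>
    rintro y rfl
    simp
  | succ m ih =>
    intro y hy
    obtain ⟨z, hz, hyz⟩ := mem_iterBall_succ.1 hy
    have h1 := h hyz
    rw [Real.dist_eq] at h1
    have h2 := abs_sub_abs_le_abs_sub (f y) (f z)
    have h3 := ih z hz
    push_cast
    linarith

theorem infDist_iterBall_le {x y : X} {ε : ℝ} {m : ℕ} (hy : y ∈ iterBall x ε (m + 1)) :
    Metric.infDist y (iterBall x ε m) ≤ ε := by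
  obtain ⟨z, hz, hyz⟩ := mem_iterBall_succ.1 hy
  exact (Metric.infDist_le_dist_of_mem hz).trans hyz.le

theorem le_infDist_iterBall {x y : X} {ε : ℝ} (hε : 0 < ε) {m : ℕ}
    (hy : y ∉ iterBall x ε (m + 1)) : ε ≤ Metric.infDist y (iterBall x ε m) := by
  refine (Metric.le_infDist (iterBall_nonempty x hε m)).2 fun z hz => ?_
  by_contra! h
  exact hy (mem_iterBall_succ.2 ⟨z, hz, h⟩)

/-! ### Chain components -/

/-- The equivalence relation whose classes are the `ε`-chain components of `X`. -/
def chainSetoid (X : Type u) [MetricSpace X] (ε : ℝ) : Setoid X where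
  r := Relation.ReflTransGen fun x y => dist x y < ε
  iseqv :=
    { refl := fun _ => Relation.ReflTransGen.refl
      symm := fun h => by
        have : Std.Symm fun x y : X => dist x y < ε := ⟨fun x y h => by rwa [dist_comm]⟩
        exact Relation.ReflTransGen.stdSymm.symm _ _ h
      trans := Relation.ReflTransGen.trans }

theorem chainSetoid_of_dist_lt {x y : X} {ε : ℝ} (h : dist x y < ε) : chainSetoid X ε x y :=
  Relation.ReflTransGen.single h

theorem chainSetoid_iff_exists_mem_iterBall {x y : X} {ε : ℝ} :
    chainSetoid X ε x y ↔ ∃ m, y ∈ iterBall x ε m := by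
  constructor
  · intro h
    change Relation.ReflTransGen _ x y at h
    induction h with
    | refl => exact ⟨0, rfl⟩
    | tail _ h ih =>
      obtain ⟨m, hm⟩ := ih
      exact ⟨m + 1, mem_iterBall_succ.2 ⟨_, hm, by rwa [dist_comm]⟩⟩
  · rintro ⟨m, hm⟩
    induction m generalizing y with
    | zero =>
      obtain rfl : y = x := hm
      exact Setoid.refl' _ _
    | succ m ih =>
      obtain ⟨z, hz, hyz⟩ := mem_iterBall_succ.1 hm
      exact Setoid.trans' _ (ih hz) (chainSetoid_of_dist_lt (by rwa [dist_comm]))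

theorem isUniformPartition_classes_chainSetoid {ε : ℝ} (hε : 0 < ε) :
    IsUniformPartition (chainSetoid X ε).classes := by
  refine ⟨Setoid.isPartition_classes _, ε, hε, fun x => ⟨_, Setoid.mem_classes _ x, ?_⟩⟩
  exact fun y hy => chainSetoid_of_dist_lt hy

theorem uniformContinuous_comp_mk_chainSetoid {ε : ℝ} (hε : 0 < ε)
    (h : Quotient (chainSetoid X ε) → ℝ) :
    UniformContinuous fun x : X => h (Quotient.mk _ x) := by
  refine Metric.uniformContinuous_iff.2 fun δ hδ => ⟨ε, hε, fun {a b} hab => ?_⟩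
  rw [Quotient.sound (s := chainSetoid X ε) (chainSetoid_of_dist_lt hab)]
  simpa using hδ

/-- The least `k` such that `y` lies in the iterated ball `B^{k+1}(x, ε)`; it has the junk value `0`
outside the chain component of `x`. -/
noncomputable def chainIndex (x : X) (ε : ℝ) (y : X) : ℕ :=
  sInf {m | y ∈ iterBall x ε (m + 1)}

open Classical in
/-- A uniformly continuous variant of `ε` times the number of `ε`-steps from `x` to `y`, set to `0`
outside the chain component of `x`. -/
noncomputable def chainHeight (x : X) (ε : ℝ) (y : X) : ℝ :=
  if chainSetoid X ε x y then
    chainIndex x ε y * ε + Metric.infDist y (iterBall x ε (chainIndex x ε y)) else 0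

theorem mem_iterBall_chainIndex {x y : X} {ε : ℝ} (hε : 0 < ε) (h : chainSetoid X ε x y) :
    y ∈ iterBall x ε (chainIndex x ε y + 1) := by
  obtain ⟨m, hm⟩ := chainSetoid_iff_exists_mem_iterBall.1 h
  exact Nat.sInf_mem (s := {m | y ∈ iterBall x ε (m + 1)}) ⟨m, iterBall_mono x hε m.le_succ hm⟩

theorem chainIndex_le_succ_of_dist_lt {x y z : X} {ε : ℝ} (hε : 0 < ε) (hy : chainSetoid X ε x y)
    (hyz : dist y z < ε) : chainIndex x ε z ≤ chainIndex x ε y + 1 :=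
  Nat.sInf_le (mem_iterBall_succ.2 ⟨y, mem_iterBall_chainIndex hε hy, by rwa [dist_comm]⟩)

/-- The key estimate: at points less than `ε` apart, of which the first has at most the index of the
second, the heights differ by at most twice the distance. -/
theorem abs_chainHeight_sub_le_of_chainIndex_le {x y z : X} {ε : ℝ} (hε : 0 < ε)
    (hy : chainSetoid X ε x y) (hyz : dist y z < ε) (hle : chainIndex x ε y ≤ chainIndex x ε z) :
    |chainHeight x ε z - chainHeight x ε y| ≤ 2 * dist y z := by
  have hz : chainSetoid X ε x z := Setoid.trans' _ hy (chainSetoid_of_dist_lt hyz)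
  have hmy := mem_iterBall_chainIndex hε hy
  have hle' := chainIndex_le_succ_of_dist_lt hε hy hyz
  have hd : 0 ≤ dist y z := dist_nonneg
  rw [chainHeight, chainHeight, if_pos hz, if_pos hy]
  generalize hk : chainIndex x ε y = k at *
  have h1 := Metric.infDist_le_infDist_add_dist (s := iterBall x ε k) (x := y) (y := z)
  have h2 := Metric.infDist_le_infDist_add_dist (s := iterBall x ε k) (x := z) (y := y)
  rw [dist_comm z y] at h2
  rcases hle.eq_or_lt with h | h
  · rw [← h, abs_le]
    constructor <;> linarith
  · have hkz : chainIndex x ε z = k + 1 := by omega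
    have h3 : ε ≤ Metric.infDist z (iterBall x ε k) :=
      le_infDist_iterBall hε fun hz' => by
        have := Nat.sInf_le (s := {m | z ∈ iterBall x ε (m + 1)}) hz'
        change chainIndex x ε z ≤ k at this
        omega
    have h4 := infDist_iterBall_le hmy
    have h5 : Metric.infDist z (iterBall x ε (k + 1)) ≤ dist z y :=
      Metric.infDist_le_dist_of_mem hmy
    have h6 : 0 ≤ Metric.infDist z (iterBall x ε (k + 1)) := Metric.infDist_nonneg
    rw [dist_comm z y] at h5
    rw [hkz, abs_le]
    push_cast
    constructor <;> linarith

theorem uniformContinuous_chainHeight (x : X) {ε : ℝ} (hε : 0 < ε) :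
    UniformContinuous (chainHeight x ε) := by
  refine Metric.uniformContinuous_iff.2 fun δ hδ =>
    ⟨min ε (δ / 2), lt_min hε (half_pos hδ), fun {a b} hab => ?_⟩
  have h1 : dist a b < ε := hab.trans_le (min_le_left _ _)
  have h2 : dist a b < δ / 2 := hab.trans_le (min_le_right _ _)
  have h1' : dist b a < ε := by rwa [dist_comm]
  by_cases ha : chainSetoid X ε x a
  · have hb : chainSetoid X ε x b := Setoid.trans' _ ha (chainSetoid_of_dist_lt h1)
    rcases le_total (chainIndex x ε a) (chainIndex x ε b) with h | h
    · have := abs_chainHeight_sub_le_of_chainIndex_le hε ha h1 h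
      rw [dist_comm, Real.dist_eq]
      linarith
    · have := abs_chainHeight_sub_le_of_chainIndex_le hε hb h1' h
      rw [dist_comm b a] at this
      rw [Real.dist_eq]
      linarith
  · have hb : ¬ chainSetoid X ε x b := fun hb =>
      ha (Setoid.trans' _ hb (chainSetoid_of_dist_lt h1'))
    rw [chainHeight, chainHeight, if_neg ha, if_neg hb]
    simpa using hδ

theorem mem_iterBall_of_chainHeight_le {x y : X} {ε K : ℝ} (hε : 0 < ε) (h : chainSetoid X ε x y)
    (hK : chainHeight x ε y ≤ K) : y ∈ iterBall x ε (⌈K / ε⌉₊ + 1) := by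
  refine iterBall_mono x hε (Nat.succ_le_succ ?_) (mem_iterBall_chainIndex hε h)
  rw [chainHeight, if_pos h] at hK
  have h1 : 0 ≤ Metric.infDist y (iterBall x ε (chainIndex x ε y)) := Metric.infDist_nonneg
  have h2 : (chainIndex x ε y : ℝ) ≤ K / ε := (le_div_iff₀ hε).2 (by linarith)
  exact_mod_cast h2.trans (Nat.le_ceil _)

/-! ### The equivalence -/

theorem exists_iterBall_mem_of_bounded
    (hP : ∀ P : Set (Set X), IsUniformPartition P → ¬ IsUlamMeasurable (Cardinal.mk P))
    (l : Ultrafilter X) (hl : ∀ f : UnifFun X, ∃ K : ℝ, ∀ᶠ x in l, |(f : X → ℝ) x| ≤ K)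
    {ε : ℝ} (hε : 0 < ε) : ∃ (x : X) (m : ℕ), iterBall x ε (m + 1) ∈ l := by
  let r := chainSetoid X ε
  obtain ⟨q, hq⟩ : ∃ q : Quotient r, {q} ∈ l.map (Quotient.mk r) := by
    by_contra! hfree
    refine hP _ (isUniformPartition_classes_chainSetoid (X := X) hε) ?_
    rw [← Cardinal.mk_congr (Setoid.quotientEquivClasses r)]
    refine isUlamMeasurable_of_ultrafilter (l.map (Quotient.mk r)) (fun f => ?_) hfree
    obtain ⟨K, hK⟩ := hl ⟨fun x => f (Quotient.mk r x), uniformContinuous_comp_mk_chainSetoid hε f⟩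
    exact ⟨K, hK.mono fun x hx => (le_abs_self _).trans hx⟩
  obtain ⟨x, rfl⟩ := Quotient.exists_rep q
  have hC : ∀ᶠ y in (l : Filter X), chainSetoid X ε x y :=
    mem_of_superset hq fun y hy => Setoid.symm' _ (Quotient.exact (s := r) hy)
  obtain ⟨K, hK⟩ := hl ⟨_, uniformContinuous_chainHeight x hε⟩
  refine ⟨x, ⌈K / ε⌉₊, ?_⟩
  filter_upwards [hC, hK] with y h1 h2
  exact mem_iterBall_of_chainHeight_le hε h1 ((le_abs_self _).trans h2)

/-- Bourbaki-completeness in terms of filters, by way of the net of pairs `(s, x)` with `x ∈ s` and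
`s` in the filter, ordered by reverse inclusion of `s`. -/
theorem IsBourbakiComplete.exists_clusterPt (hX : IsBourbakiComplete X) (l : Filter X) [l.NeBot]
    (hl : ∀ ε : ℝ, 0 < ε → ∃ (x : X) (m : ℕ), iterBall x ε (m + 1) ∈ l) :
    ∃ x : X, ClusterPt x l := by
  let Λ : Type u := {p : Set X × X // p.1 ∈ l ∧ p.2 ∈ p.1}
  let : Preorder Λ := Preorder.lift fun p : Λ => OrderDual.toDual p.1.1
  have hmk : ∀ s ∈ l, ∃ p : Λ, p.1.1 = s := fun s hs => by
    obtain ⟨x, hx⟩ := l.nonempty_of_mem hs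
    exact ⟨⟨(s, x), hs, hx⟩, rfl⟩
  have : IsDirectedOrder Λ := ⟨fun p q => by
    obtain ⟨t, ht⟩ := hmk _ (inter_mem p.2.1 q.2.1)
    refine ⟨t, ?_, ?_⟩
    · change t.1.1 ⊆ p.1.1
      exact ht ▸ Set.inter_subset_left
    · change t.1.1 ⊆ q.1.1
      exact ht ▸ Set.inter_subset_right⟩
  have : Nonempty Λ := ⟨(hmk _ univ_mem).choose⟩
  have hev : ∀ s ∈ l, ∃ p₀ : Λ, ∀ p, p₀ ≤ p → p.1.2 ∈ s := fun s hs => by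
    obtain ⟨p₀, hp₀⟩ := hmk s hs
    refine ⟨p₀, fun p hp => ?_⟩
    have hp' : p.1.1 ⊆ p₀.1.1 := hp
    exact hp₀ ▸ hp' p.2.2
  obtain ⟨x, hx⟩ := hX Λ (fun p => p.1.2) fun ε hε => by
    obtain ⟨x, m, hm⟩ := hl ε hε
    obtain ⟨p₀, hp₀⟩ := hev _ hm
    exact ⟨m + 1, Nat.le_add_left 1 m, p₀, x, hp₀⟩
  refine ⟨x, ClusterPt.mono hx fun s hs => ?_⟩
  obtain ⟨p₀, hp₀⟩ := hev s hs
  exact mem_map.2 (mem_of_superset (mem_atTop p₀) hp₀)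

theorem IsBourbakiComplete.isSamuelRealcompact (hX : IsBourbakiComplete X)
    (hP : ∀ P : Set (Set X), IsUniformPartition P → ¬ IsUlamMeasurable (Cardinal.mk P)) :
    IsSamuelRealcompact X :=
  isSamuelRealcompact_of_forall_ultrafilter fun l hl => by
    obtain ⟨x, hx⟩ := hX.exists_clusterPt l fun ε hε => exists_iterBall_mem_of_bounded hP l hl hε
    exact ⟨x, Ultrafilter.clusterPt_iff.1 hx⟩

theorem IsSamuelRealcompact.isBourbakiComplete (hX : IsSamuelRealcompact X) :
    IsBourbakiComplete X := by
  intro Λ _ _ _ a ha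
  let l : Ultrafilter X := Ultrafilter.of (map a atTop)
  have hle : (l : Filter X) ≤ map a atTop := Ultrafilter.of_le _
  obtain ⟨x, hx⟩ := hX.exists_le_nhds l fun f => by
    obtain ⟨ε, hε, h⟩ := UniformContinuous.exists_abs_le_on_iterBall f.2
    obtain ⟨m, -, p₀, x₀, hp₀⟩ := ha ε hε
    refine ⟨|(f : X → ℝ) x₀| + m, ?_⟩
    have h1 : iterBall x₀ ε m ∈ map a atTop :=
      mem_map.2 (mem_of_superset (mem_atTop p₀) hp₀)
    exact mem_of_superset (hle h1) (h x₀ m)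
  exact ⟨x, (Ultrafilter.clusterPt_iff.2 hx).mono hle⟩

theorem IsSamuelRealcompact.not_isUlamMeasurable (hX : IsSamuelRealcompact X) (S : Set X)
    (hS : IsUniformlyDiscreteSet S) : ¬ IsUlamMeasurable (Cardinal.mk S) := by
  intro hm
  obtain ⟨l, hl, hfree⟩ := hm.exists_ultrafilter
  obtain ⟨ε, hε, hsep⟩ := hS
  obtain ⟨x, hx⟩ := hX.exists_le_nhds (l.map Subtype.val) fun f =>
    l.exists_eventually_abs_le_of_countableInter fun s => (f : X → ℝ) s
  -- A ball of radius `ε / 2` contains at most one point of `S`.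
  have h1 : {s : S | dist (s : X) x < ε / 2} ∈ l := hx (Metric.ball_mem_nhds x (half_pos hε))
  obtain ⟨s, hs⟩ := l.nonempty_of_mem h1
  refine hfree s (mem_of_superset h1 fun t ht => ?_)
  by_contra hts
  have h2 := hsep t.2 s.2 fun h => hts (Subtype.ext h)
  have h3 := dist_triangle_right (t : X) s x
  simp only [Set.mem_ofPred_eq] at hs ht
  linarith

theorem IsUniformPartition.exists_isUniformlyDiscreteSet {P : Set (Set X)}
    (hP : IsUniformPartition P) :
    ∃ S : Set X, IsUniformlyDiscreteSet S ∧ Cardinal.mk S = Cardinal.mk P := by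
  obtain ⟨hpart, ε, hε, hball⟩ := hP
  choose c hc using fun A : P => Setoid.nonempty_of_mem_partition hpart A.2
  -- A member of `P` containing `c A` is `A` itself.
  have hcA : ∀ A : P, Metric.ball (c A) ε ⊆ A := fun A => by
    obtain ⟨B, hB, hAB⟩ := hball (c A)
    rwa [← (hpart.2 (c A)).unique ⟨hB, hAB (Metric.mem_ball_self hε)⟩ ⟨A.2, hc A⟩]
  have hinj : ∀ A B : P, dist (c A) (c B) < ε → A = B := fun A B h =>
    Subtype.ext ((hpart.2 (c A)).unique ⟨A.2, hc A⟩ ⟨B.2, hcA B h⟩)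
  refine ⟨Set.range c, ⟨ε / 2, half_pos hε, ?_⟩, Cardinal.mk_range_eq c fun A B h => ?_⟩
  · rintro _ ⟨A, rfl⟩ _ ⟨B, rfl⟩ hne
    by_contra! h
    exact hne (congrArg c (hinj A B (h.trans_lt (half_lt_self hε))))
  · exact hinj A B (by rwa [h, dist_self])

end

theorem mainTheorem1 (X : Type u) [MetricSpace X] :
    (IsSamuelRealcompact X ↔
      IsBourbakiComplete X ∧
        ∀ S : Set X, IsUniformlyDiscreteSet S → ¬ IsUlamMeasurable (Cardinal.mk S)) ∧
    (IsSamuelRealcompact X ↔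
      IsBourbakiComplete X ∧
        ∀ P : Set (Set X), IsUniformPartition P → ¬ IsUlamMeasurable (Cardinal.mk P)) := by
  have h : (∀ S : Set X, IsUniformlyDiscreteSet S → ¬ IsUlamMeasurable (Cardinal.mk S)) →
      ∀ P : Set (Set X), IsUniformPartition P → ¬ IsUlamMeasurable (Cardinal.mk P) := by
    intro hS P hP
    obtain ⟨S, hSd, hcard⟩ := hP.exists_isUniformlyDiscreteSet
    exact hcard ▸ hS S hSd
  exact ⟨⟨fun hX => ⟨hX.isBourbakiComplete, hX.not_isUlamMeasurable⟩,
      fun hX => hX.1.isSamuelRealcompact (h hX.2)⟩,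
    ⟨fun hX => ⟨hX.isBourbakiComplete, h hX.not_isUlamMeasurable⟩,
      fun hX => hX.1.isSamuelRealcompact hX.2⟩⟩
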